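/- Fix integers $K,d\ge 1$, real constants $\alpha,\beta>0$, and a group $\mathcal G\in\{\mathcal O(d),\mathcal{SO}(d)\}$, where $d\ge 2$ if $\mathcal G=\mathcal{SO}(d)$. For $n$ divisible by $K$ put $m=n/K$, $p=\frac{\alpha\log n}{n}$, $q=\frac{\beta\log n}{n}$. Let $C^*:[n]\to[K]$ be a map all of whose fibres have size $m$, let $R_1^*,\dots,R_n^*\in\mathcal G$, and let $V^*\in\mathbb R^{nd\times Kd}$ be the matrix whose $(i,k)$-th $d\times d$ block is $R_i^*$ if $C^*(i)=k$ and $0$ otherwise. Let $A\in\mathbb R^{nd\times nd}$ be the random symmetric matrix of the stochastic group block model: its diagonal $d\times d$ blocks are $I_d$; for $i<j$, $A_{ij}=w_{ij}R_i^*R_j^{*\top}$ if $C^*(i)=C^*(j)$ and $A_{ij}=u_{ij}R_{ij}$ if $C^*(i)\ne C^*(j)$, with all $w_{ij}\sim\mathrm{Bern}(p)$, $u_{ij}\sim\mathrm{Bern}(q)$, $R_{ij}\sim\mathrm{Unif}(\mathcal G)$ (Haar measure) independent; and $A_{ji}=A_{ij}^\top$. For $X\in\mathbb R^{nd\times Kd}$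 let $\mu(X)\in\mathbb R^{n\times K}$ be the matrix of the nuclear norms of the $d\times d$ blocks of $X$. Suppose that $$\sqrt{2K\beta}<\alpha\qquad\text{and}\qquad \alpha-\sqrt{2K\beta}\,\log\frac{e\alpha}{\sqrt{2K\beta}}>K .$$ Then there are constants $\chi>0$, $c>0$ and $N$, depending only on $\alpha,\beta,K,d,\mathcal G$, such that for all $n\ge N$ divisible by $K$ and all $C^*$, $R_1^*,\dots,R_n^*$ as above, the following two conditions hold simultaneously with probability at least $1-n^{-c}$: (i) $\mu(AV^*)_{iC^*(i)}-\mu(AV^*)_{ij}\ge\chi mp>0$ for all $i\in[n]$ and all $j\in[K]$ with $j\neq C^*(i)$; (ii) $\mu(AV^*)_{iC^*(i)}\ge\frac{\sqrt{2K\beta}}{\alpha}\,mp$ for all $i\in[n]$. Moreover, for every $K\ge 1$ this parameter region goes below the information-theoretic threshold $\sqrt\alpha-\sqrt\beta>\sqrt K$ of the stochastic block model: there are $\alpha,\beta>0$ that satisfy the two displayed inequalities and $\sqrt\alpha-\sqrt\beta<\sqrt K$. -/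

import Mathlib

open MeasureTheory ProbabilityTheory

noncomputable section

/-- The two kinds of groups that are synchronized: `O(d)` and `SO(d)`. -/
inductive SyncGroup where
  | orthogonal
  | special

/-- The group itself, as a subgroup of Mathlib's `Matrix.orthogonalGroup`: either all of `O(d)`,
or `SO(d)`, the kernel of the determinant on `O(d)`. -/
def SyncGroup.grp (G : SyncGroup) (d : ℕ) : Subgroup (Matrix.orthogonalGroup (Fin d) ℝ) :=
  match G with
  | .orthogonal => ⊤
  | .special => (Matrix.detMonoidHom.comp (Matrix.orthogonalGroup (Fin d) ℝ).subtype).ker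

/-- The `d × d` real matrix underlying a group element. -/
def SyncGroup.mat {G : SyncGroup} {d : ℕ} (g : G.grp d) : Matrix (Fin d) (Fin d) ℝ :=
  ((g : Matrix.orthogonalGroup (Fin d) ℝ) : Matrix (Fin d) (Fin d) ℝ)

instance SyncGroup.instMeasurableSpace (G : SyncGroup) (d : ℕ) : MeasurableSpace (G.grp d) :=
  borel _

instance SyncGroup.instBorelSpace (G : SyncGroup) (d : ℕ) : BorelSpace (G.grp d) := ⟨rfl⟩

theorem isCompact_orthogonalGroup (d : ℕ) :
    IsCompact (Matrix.orthogonalGroup (Fin d) ℝ : Set (Matrix (Fin d) (Fin d) ℝ)) := by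
  have hK : IsCompact (Set.pi Set.univ fun _ : Fin d => Set.pi Set.univ fun _ : Fin d =>
      Set.Icc (-1 : ℝ) 1) :=
    isCompact_univ_pi fun _ => isCompact_univ_pi fun _ => isCompact_Icc
  have hc : IsClosed
      (Matrix.orthogonalGroup (Fin d) ℝ : Set (Matrix (Fin d) (Fin d) ℝ)) := by
    have : (Matrix.orthogonalGroup (Fin d) ℝ : Set (Matrix (Fin d) (Fin d) ℝ)) =
        {A | A * A.transpose = 1} := by
      ext A
      exact Matrix.mem_orthogonalGroup_iff _ _
    rw [this]
    exact isClosed_eq (by fun_prop) continuous_const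
  refine IsCompact.of_isClosed_subset hK hc ?_
  intro A hA i _ j _
  have h := entry_norm_bound_of_unitary (𝕜 := ℝ) hA i j
  exact abs_le.mp h

instance (d : ℕ) : CompactSpace (Matrix.orthogonalGroup (Fin d) ℝ) :=
  isCompact_iff_compactSpace.mp (isCompact_orthogonalGroup d)

instance SyncGroup.instCompactSpace (G : SyncGroup) (d : ℕ) : CompactSpace (G.grp d) := by
  refine isCompact_iff_compactSpace.mp (IsClosed.isCompact ?_)
  cases G with
  | orthogonal => exact isClosed_univ
  | special =>
    change IsClosed {g : Matrix.orthogonalGroup (Fin d) ℝ |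
      (g : Matrix (Fin d) (Fin d) ℝ).det = 1}
    exact isClosed_eq (Continuous.matrix_det continuous_subtype_val) continuous_const

/-- `Unif(G)`: the Haar measure of total mass one. -/
def SyncGroup.unif (G : SyncGroup) (d : ℕ) : Measure (G.grp d) :=
  Measure.haarMeasure (⊤ : TopologicalSpace.PositiveCompacts (G.grp d))

/-- `C : [n] → [K]` is a (balanced) clustering function: every cluster has size `n / K`. -/
def IsClustering {n K : ℕ} (C : Fin n → Fin K) : Prop :=
  ∀ k, K * (Finset.univ.filter fun i => C i = k).card = n

/-- The `(i, j)` block of size `d × d` of a block matrix. -/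
def blk {n m d : ℕ} (X : Matrix (Fin n × Fin d) (Fin m × Fin d) ℝ) (i : Fin n) (j : Fin m) :
    Matrix (Fin d) (Fin d) ℝ :=
  Matrix.of fun a b => X (i, a) (j, b)

/-- The matrix `(1_{1×K} ⊗ R) ⊙ (H ⊗ 1_{d×d})`, where `H` is the clustering matrix of `C`: its
`(i, k)` block is `R i` if `C i = k`, and `0` otherwise. -/
def groundTruth {n K d : ℕ} {G : SyncGroup} (C : Fin n → Fin K) (R : Fin n → G.grp d) :
    Matrix (Fin n × Fin d) (Fin K × Fin d) ℝ :=
  Matrix.of fun x y => if C x.1 = y.1 then SyncGroup.mat (R x.1) x.2 y.2 else 0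

/-- The nuclear norm of a square matrix: the sum of its singular values. -/
def nuclearNorm {d : ℕ} (X : Matrix (Fin d) (Fin d) ℝ) : ℝ :=
  ∑ k ∈ Finset.range d, (Matrix.toEuclideanLin X).singularValues k

/-- `μ(X)`: the matrix of the nuclear norms of the blocks of `X`. -/
def blockNuclear {n K d : ℕ} (X : Matrix (Fin n × Fin d) (Fin K × Fin d) ℝ) :
    Matrix (Fin n) (Fin K) ℝ :=
  Matrix.of fun i j => nuclearNorm (blk X i j)

/-- Sample space of the stochastic group block model on `n` nodes: an edge indicator and a group
element for each pair of nodes. Only the coordinates `(i, j)` with `i < j` are used. -/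
abbrev SGBMSpace (n d : ℕ) (G : SyncGroup) : Type :=
  (Fin n × Fin n → Bool) × (Fin n × Fin n → G.grp d)

/-- All coordinates are independent; the edge indicator of `(i, j)` is Bernoulli with parameter `p`
if `i`, `j` are in the same cluster and `q` otherwise; the group elements are uniform. -/
def sgbmMeasure {n K : ℕ} (C : Fin n → Fin K) (p q : unitInterval) (d : ℕ) (G : SyncGroup) :
    Measure (SGBMSpace n d G) :=
  (Measure.pi fun e : Fin n × Fin n =>
      bernoulliMeasure true false (if C e.1 = C e.2 then p else q)).prod
    (Measure.pi fun _ : Fin n × Fin n => G.unif d)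

/-- The `(i, j)` block of the observation matrix for `i < j`. -/
def obsUpper {n K d : ℕ} {G : SyncGroup} (C : Fin n → Fin K) (R : Fin n → G.grp d)
    (ω : SGBMSpace n d G) (i j : Fin n) : Matrix (Fin d) (Fin d) ℝ :=
  if ω.1 (i, j) = true then
    if C i = C j then SyncGroup.mat (R i) * (SyncGroup.mat (R j)).transpose
    else SyncGroup.mat (ω.2 (i, j))
  else 0

/-- The observation matrix `A` of the stochastic group block model. -/
def observation {n K d : ℕ} {G : SyncGroup} (C : Fin n → Fin K) (R : Fin n → G.grp d)
    (ω : SGBMSpace n d G) : Matrix (Fin n × Fin d) (Fin n × Fin d) ℝ :=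
  Matrix.of fun x y =>
    (if x.1 < y.1 then obsUpper C R ω x.1 y.1
      else if y.1 < x.1 then (obsUpper C R ω y.1 x.1).transpose
      else 1) x.2 y.2

/-- The observation matrix `A` preserves `V` (with clustering function `C`) by `δ`-separation. -/
def PreservesBySeparation {n K d : ℕ} (A : Matrix (Fin n × Fin d) (Fin n × Fin d) ℝ)
    (C : Fin n → Fin K) (V : Matrix (Fin n × Fin d) (Fin K × Fin d) ℝ) (δ : ℝ) : Prop :=
  0 < δ ∧ ∀ i j, j ≠ C i → δ ≤ blockNuclear (A * V) i (C i) - blockNuclear (A * V) i j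

/-- The region `√(2Kβ) < α`, `α - √(2Kβ) log (eα / √(2Kβ)) > K` of the parameters. -/
def InRegion (K : ℕ) (α β : ℝ) : Prop :=
  Real.sqrt (2 * K * β) < α ∧
    (K : ℝ) < α - Real.sqrt (2 * K * β) *
      Real.log (Real.exp 1 * α / Real.sqrt (2 * K * β))

end

/-! Write `W` for 1 plus the number of edges from node `i` to the rest of its cluster. The planted
rotations cancel in the own block of `A V`, which is `W` times an orthogonal matrix and has nuclear
norm `d W`. A foreign block `S` is a sum of independent Haar elements, each kept with probability
`q` and multiplied by orthogonal matrices. The nuclear norm of `S` is the maximum of `tr(Oᵀ S)` over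
orthogonal `O`. By compactness a finite net of `O`, independent of `n`, gives it up to a factor `1 -
ε`, so a union bound over the net costs only a constant. For fixed `O` the summands have mean zero
and modulus at most `d`, whence `E exp((l/d) tr) ≤ cosh l`. A joint Chernoff bound for `tr(Oᵀ S)/d -
(1 - ε) W` has, in units of `log n` and as `ε → 0`, the exponent `(β/K)(cosh l - 1) - (α/K)(1 -
e⁻ˡ)`. Its minimum over `l` is below `-1` exactly when `α > K + √(2Kβ)`, which the region implies
(`exists_chernoff_exponent_lt`). Condition (ii) is the Chernoff lower tail of `W`; its exponent
beats `-1` exactly by the second inequality of the region. Both exponents below `-1` leave room for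
a union bound over the `n` nodes. -/

/-! ### Singular values, nuclear norm and its duality with the orthogonal group -/

theorem trace_transpose_mul_eq_sum_inner {d : ℕ} (D S : Matrix (Fin d) (Fin d) ℝ)
    (v : OrthonormalBasis (Fin d) ℝ (EuclideanSpace ℝ (Fin d))) :
    (D.transpose * S).trace =
      ∑ k, inner ℝ (Matrix.toEuclideanLin D (v k)) (Matrix.toEuclideanLin S (v k)) := by
  have h1 : LinearMap.trace ℝ _ (Matrix.toEuclideanLin (D.transpose * S)) =
      (D.transpose * S).trace := by
    rw [Matrix.toEuclideanLin_eq_toLin_orthonormal, Matrix.trace_toLin_eq]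
  rw [← h1, LinearMap.trace_eq_sum_inner _ v]
  refine Finset.sum_congr rfl fun k _ => ?_
  have h2 : Matrix.toEuclideanLin (D.transpose * S) (v k) =
      Matrix.toEuclideanLin D.transpose (Matrix.toEuclideanLin S (v k)) := by
    simp [Matrix.toLpLin_apply, Matrix.mulVec_mulVec]
  have h3 : Matrix.toEuclideanLin D.transpose = LinearMap.adjoint (Matrix.toEuclideanLin D) := by
    rw [← Matrix.toEuclideanLin_conjTranspose_eq_adjoint]
    simp
  rw [h2, h3, LinearMap.adjoint_inner_right]

/-- Singular value decomposition. -/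
theorem exists_singularValueDecomposition {d : ℕ} (S : Matrix (Fin d) (Fin d) ℝ) :
    ∃ (v u : OrthonormalBasis (Fin d) ℝ (EuclideanSpace ℝ (Fin d))) (σ : Fin d → ℝ),
      (∀ k, 0 ≤ σ k) ∧ nuclearNorm S = ∑ k, σ k ∧
        ∀ k, Matrix.toEuclideanLin S (v k) = σ k • u k := by
  set T := Matrix.toEuclideanLin S
  have hn : Module.finrank ℝ (EuclideanSpace ℝ (Fin d)) = d := by simp
  set hT := T.isSymmetric_adjoint_comp_self
  set v := hT.eigenvectorBasis hn
  set σ : Fin d → ℝ := fun k => T.singularValues k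
  have hσ : ∀ k, 0 ≤ σ k := fun k => T.singularValues_nonneg k
  have hin : ∀ k l, inner ℝ (T (v k)) (T (v l)) = if k = l then σ l ^ 2 else 0 := by
    intro k l
    have h1 : LinearMap.adjoint T (T (v l)) = (σ l ^ 2) • v l := by
      have := hT.apply_eigenvectorBasis hn l
      rw [← T.sq_singularValues_fin hn l] at this
      exact this
    rw [← LinearMap.adjoint_inner_right, h1, inner_smul_right,
      orthonormal_iff_ite.mp v.orthonormal]
    simp
  -- The images of the eigenvectors of `T* T` are orthogonal with norms `σ k`; the nonzero ones,
  -- normalized, extend to an orthonormal basis.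
  let s : Set (Fin d) := {k | σ k ≠ 0}
  have hon : Orthonormal ℝ (s.domRestrict fun k => (σ k)⁻¹ • T (v k)) := by
    rw [orthonormal_iff_ite]
    rintro ⟨k, hk⟩ ⟨l, hl⟩
    simp only [Set.domRestrict_apply, inner_smul_left, inner_smul_right, hin, Subtype.mk.injEq]
    split_ifs with h
    · subst h
      have : σ k ≠ 0 := hk
      simp
      field_simp
    · simp
  obtain ⟨u, hu⟩ := hon.exists_orthonormalBasis_extension_of_card_eq (by simp)
  refine ⟨v, u, σ, hσ, Finset.sum_range _, fun k => ?_⟩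
  by_cases hk : σ k = 0
  · have := hin k k
    rw [if_pos rfl, hk] at this
    rw [hk, zero_smul]
    simpa using this
  · rw [hu k hk, smul_smul, mul_inv_cancel₀ hk, one_smul]

/-- Duality of operator norm and nuclear norm: in a singular basis of `S` the trace is a sum of
terms of size at most `c * σ k`. -/
theorem abs_trace_transpose_mul_le {d : ℕ} (D S : Matrix (Fin d) (Fin d) ℝ) {c : ℝ}
    (hD : ∀ x, ‖Matrix.toEuclideanLin D x‖ ≤ c * ‖x‖) :
    |(D.transpose * S).trace| ≤ c * nuclearNorm S := by
  obtain ⟨v, u, σ, hσ, hS, hv⟩ := exists_singularValueDecomposition S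
  rw [trace_transpose_mul_eq_sum_inner D S v, hS, Finset.mul_sum]
  refine (Finset.abs_sum_le_sum_abs _ _).trans (Finset.sum_le_sum fun k _ => ?_)
  rw [hv]
  refine (abs_real_inner_le_norm _ _).trans ?_
  have := hD (v k)
  simp only [OrthonormalBasis.norm_eq_one, mul_one] at this
  rw [norm_smul]
  simp only [OrthonormalBasis.norm_eq_one, mul_one, Real.norm_of_nonneg (hσ k)]
  exact mul_le_mul_of_nonneg_right this (hσ k)

/-- The nuclear norm is attained as a pairing with an orthogonal matrix (polar decomposition). -/
theorem exists_orthogonal_trace_eq_nuclearNorm {d : ℕ} (S : Matrix (Fin d) (Fin d) ℝ) :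
    ∃ O ∈ Matrix.orthogonalGroup (Fin d) ℝ, (O.transpose * S).trace = nuclearNorm S := by
  obtain ⟨v, u, σ, hσ, hS, hv⟩ := exists_singularValueDecomposition S
  let E := v.equiv u (Equiv.refl _)
  let O : Matrix (Fin d) (Fin d) ℝ := Matrix.toEuclideanLin.symm E.toLinearEquiv.toLinearMap
  have hO : ∀ x, Matrix.toEuclideanLin O x = E x := by
    intro x
    simp [O]
  refine ⟨O, ?_, ?_⟩
  · rw [Matrix.mem_orthogonalGroup_iff']
    apply Matrix.toEuclideanLin.injective
    have h3 : Matrix.toEuclideanLin O.transpose =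
        LinearMap.adjoint (Matrix.toEuclideanLin O) := by
      rw [← Matrix.toEuclideanLin_conjTranspose_eq_adjoint]
      simp
    have h2 : ∀ x, Matrix.toEuclideanLin (O.transpose * O) x =
        LinearMap.adjoint (Matrix.toEuclideanLin O) (Matrix.toEuclideanLin O x) := by
      intro x
      rw [← h3]
      simp [Matrix.toLpLin_apply, Matrix.mulVec_mulVec]
    ext1 x
    refine ext_inner_left ℝ fun y => ?_
    change inner ℝ y (Matrix.toEuclideanLin (O.transpose * O) x) = _
    rw [h2, LinearMap.adjoint_inner_right, hO, hO, E.inner_map_map]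
    simp
  · rw [trace_transpose_mul_eq_sum_inner O S v, hS]
    refine Finset.sum_congr rfl fun k _ => ?_
    rw [hv, hO]
    simp [E, inner_smul_right]

theorem norm_toEuclideanLin_of_mem_orthogonalGroup {d : ℕ} {O : Matrix (Fin d) (Fin d) ℝ}
    (hO : O ∈ Matrix.orthogonalGroup (Fin d) ℝ) (x : EuclideanSpace ℝ (Fin d)) :
    ‖Matrix.toEuclideanLin O x‖ = ‖x‖ := by
  have h3 : Matrix.toEuclideanLin O.transpose =
      LinearMap.adjoint (Matrix.toEuclideanLin O) := by
    rw [← Matrix.toEuclideanLin_conjTranspose_eq_adjoint]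
    simp
  have h2 : LinearMap.adjoint (Matrix.toEuclideanLin O) (Matrix.toEuclideanLin O x) = x := by
    rw [← h3]
    simp [Matrix.toLpLin_apply, Matrix.mulVec_mulVec, (Matrix.mem_orthogonalGroup_iff' _ _).mp hO]
  have h : ‖Matrix.toEuclideanLin O x‖ ^ 2 = ‖x‖ ^ 2 := by
    rw [← real_inner_self_eq_norm_sq, ← LinearMap.adjoint_inner_right, h2,
      real_inner_self_eq_norm_sq]
  exact (sq_eq_sq₀ (norm_nonneg _) (norm_nonneg _)).mp h

theorem nuclearNorm_smul_of_mem_orthogonalGroup {d : ℕ} {O : Matrix (Fin d) (Fin d) ℝ}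
    (hO : O ∈ Matrix.orthogonalGroup (Fin d) ℝ) {c : ℝ} (hc : 0 ≤ c) :
    nuclearNorm (c • O) = d * c := by
  obtain ⟨v, u, σ, hσ, hS, hv⟩ := exists_singularValueDecomposition (c • O)
  have hk : ∀ k, σ k = c := by
    intro k
    have h := congrArg norm (hv k)
    rw [norm_smul, map_smul, LinearMap.smul_apply, norm_smul,
      norm_toEuclideanLin_of_mem_orthogonalGroup hO] at h
    simpa [abs_of_nonneg hc, abs_of_nonneg (hσ k)] using h.symm
  rw [hS]
  simp [hk]

theorem abs_trace_transpose_mul_le_of_mem_orthogonalGroup {d : ℕ}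
    {O Q : Matrix (Fin d) (Fin d) ℝ} (hO : O ∈ Matrix.orthogonalGroup (Fin d) ℝ)
    (hQ : Q ∈ Matrix.orthogonalGroup (Fin d) ℝ) : |(O.transpose * Q).trace| ≤ d := by
  have h := abs_trace_transpose_mul_le O Q (c := 1)
    fun x => by rw [one_mul, norm_toEuclideanLin_of_mem_orthogonalGroup hO]
  have h1 := nuclearNorm_smul_of_mem_orthogonalGroup hQ zero_le_one
  rw [one_smul] at h1
  rw [h1] at h
  simpa using h

/-- A finite `ε`-net of the orthogonal group computes nuclear norms up to a factor `1 - ε`. -/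
theorem exists_finite_net_nuclearNorm (d : ℕ) {ε : ℝ} (hε : 0 < ε) :
    ∃ N : Finset (Matrix (Fin d) (Fin d) ℝ), (∀ O ∈ N, O ∈ Matrix.orthogonalGroup (Fin d) ℝ) ∧
      ∀ S : Matrix (Fin d) (Fin d) ℝ, ∃ O ∈ N,
        (1 - ε) * nuclearNorm S ≤ (O.transpose * S).trace := by
  let U : Matrix (Fin d) (Fin d) ℝ → Set (Matrix (Fin d) (Fin d) ℝ) :=
    fun O => {B | ‖Matrix.toEuclideanCLM (n := Fin d) (𝕜 := ℝ) (B - O)‖ < ε}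
  have hcont : Continuous fun B : Matrix (Fin d) (Fin d) ℝ =>
      Matrix.toEuclideanCLM (n := Fin d) (𝕜 := ℝ) B :=
    LinearMap.continuous_of_finiteDimensional
      (Matrix.toEuclideanCLM (n := Fin d) (𝕜 := ℝ)).toAlgEquiv.toLinearMap
  have hU : ∀ O ∈ (Matrix.orthogonalGroup (Fin d) ℝ : Set (Matrix (Fin d) (Fin d) ℝ)),
      U O ∈ nhds O := by
    intro O _
    refine IsOpen.mem_nhds ?_ (by simpa [U] using hε)
    exact isOpen_lt (hcont.comp (continuous_id.sub continuous_const)).norm continuous_const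
  obtain ⟨N, hN, hcov⟩ := (isCompact_orthogonalGroup d).elim_nhds_subcover U hU
  refine ⟨N, hN, fun S => ?_⟩
  obtain ⟨B, hB, hBS⟩ := exists_orthogonal_trace_eq_nuclearNorm S
  obtain ⟨O, hON, hO⟩ := Set.mem_iUnion₂.mp (hcov hB)
  refine ⟨O, hON, ?_⟩
  -- Replacing the polar factor `B` of `S` by a net point within `ε` in operator norm changes the
  -- pairing by at most `ε` times the nuclear norm.
  have h := abs_trace_transpose_mul_le (B - O) S (c := ε) fun x => by
    have h1 := (Matrix.toEuclideanCLM (n := Fin d) (𝕜 := ℝ) (B - O)).le_opNorm x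
    exact h1.trans (mul_le_mul_of_nonneg_right (le_of_lt hO) (norm_nonneg _))
  rw [Matrix.transpose_sub, Matrix.sub_mul, Matrix.trace_sub, hBS] at h
  linarith [(abs_le.mp h).2]

/-! ### Haar measure: mean zero and exponential moments -/

theorem SyncGroup.mat_mem {G : SyncGroup} {d : ℕ} (g : G.grp d) :
    SyncGroup.mat g ∈ Matrix.orthogonalGroup (Fin d) ℝ :=
  (g : Matrix.orthogonalGroup (Fin d) ℝ).2

theorem SyncGroup.mat_mul {G : SyncGroup} {d : ℕ} (g h : G.grp d) :
    SyncGroup.mat (g * h) = SyncGroup.mat g * SyncGroup.mat h := rfl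

theorem SyncGroup.continuous_mat {G : SyncGroup} {d : ℕ} :
    Continuous (SyncGroup.mat : G.grp d → Matrix (Fin d) (Fin d) ℝ) :=
  continuous_subtype_val.comp continuous_subtype_val

theorem transpose_mem_orthogonalGroup {d : ℕ} {O : Matrix (Fin d) (Fin d) ℝ}
    (hO : O ∈ Matrix.orthogonalGroup (Fin d) ℝ) :
    O.transpose ∈ Matrix.orthogonalGroup (Fin d) ℝ := by
  rw [Matrix.mem_orthogonalGroup_iff, Matrix.transpose_transpose]
  exact (Matrix.mem_orthogonalGroup_iff' _ _).mp hO

instance SyncGroup.instIsProbabilityMeasureUnif (G : SyncGroup) (d : ℕ) :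
    IsProbabilityMeasure (G.unif d) := ⟨by
  have := Measure.haarMeasure_self (K₀ := (⊤ : TopologicalSpace.PositiveCompacts (G.grp d)))
  simpa [SyncGroup.unif] using this⟩

/-- Each coordinate sign can be flipped by an element of the group. -/
theorem SyncGroup.exists_mat_mul_apply_eq_neg {G : SyncGroup} {d : ℕ}
    (hG : G = SyncGroup.special → 2 ≤ d) (a : Fin d) :
    ∃ h : G.grp d, ∀ (Q : Matrix (Fin d) (Fin d) ℝ) (b : Fin d),
      (SyncGroup.mat h * Q) a b = -Q a b := by
  obtain ⟨s, hs, hsa, hdet⟩ : ∃ s : Fin d → ℝ, (∀ c, s c * s c = 1) ∧ s a = -1 ∧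
      (G = SyncGroup.special → ∏ c, s c = 1) := by
    by_cases hG' : G = SyncGroup.special
    · have : Nontrivial (Fin d) := Fin.nontrivial_iff_two_le.mpr (hG hG')
      -- In `SO(d)` a second sign is flipped to keep the determinant 1; this is where `2 ≤ d`
      -- enters.
      obtain ⟨a', ha'⟩ := exists_ne a
      refine ⟨fun c => (if c = a then -1 else 1) * (if c = a' then -1 else 1), ?_, ?_, ?_⟩
      · intro c
        dsimp only
        split_ifs <;> norm_num
      · simp [ha'.symm]
      · intro _
        rw [Finset.prod_mul_distrib]
        simp
    · refine ⟨fun c => if c = a then -1 else 1, ?_, by simp, fun h => absurd h hG'⟩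
      intro c
      dsimp only
      split_ifs <;> norm_num
  have hmem : Matrix.diagonal s ∈ Matrix.orthogonalGroup (Fin d) ℝ := by
    rw [Matrix.mem_orthogonalGroup_iff]
    simp [Matrix.diagonal_mul_diagonal, hs]
  have hgrp : (⟨Matrix.diagonal s, hmem⟩ : Matrix.orthogonalGroup (Fin d) ℝ) ∈ G.grp d := by
    cases G with
    | orthogonal => exact Subgroup.mem_top _
    | special =>
      change Matrix.det (Matrix.diagonal s) = 1
      rw [Matrix.det_diagonal]
      exact hdet rfl
  refine ⟨⟨_, hgrp⟩, fun Q b => ?_⟩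
  change (Matrix.diagonal s * Q) a b = _
  rw [Matrix.diagonal_mul, hsa, neg_one_mul]

theorem SyncGroup.integrable_of_continuous {G : SyncGroup} {d : ℕ} {f : G.grp d → ℝ}
    (hf : Continuous f) : Integrable f (G.unif d) :=
  hf.integrable_of_hasCompactSupport (HasCompactSupport.of_compactSpace f)

/-- A Haar-distributed element of the group has mean zero. -/
theorem SyncGroup.integral_mat_apply {G : SyncGroup} {d : ℕ}
    (hG : G = SyncGroup.special → 2 ≤ d) (a b : Fin d) :
    ∫ g, SyncGroup.mat g a b ∂G.unif d = 0 := by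
  obtain ⟨h, hh⟩ := SyncGroup.exists_mat_mul_apply_eq_neg hG a
  have : (G.unif d).IsMulLeftInvariant := by
    unfold SyncGroup.unif
    infer_instance
  have h1 := integral_mul_left_eq_self (μ := G.unif d) (fun g => SyncGroup.mat g a b) h
  simp only [SyncGroup.mat_mul, hh, integral_neg] at h1
  linarith

theorem SyncGroup.integral_trace_mul_mat_mul {G : SyncGroup} {d : ℕ}
    (hG : G = SyncGroup.special → 2 ≤ d) (A B : Matrix (Fin d) (Fin d) ℝ) :
    ∫ g, (A * SyncGroup.mat g * B).trace ∂G.unif d = 0 := by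
  have h : ∀ g : G.grp d, (A * SyncGroup.mat g * B).trace =
      ∑ b, ∑ a, (B * A) b a * SyncGroup.mat g a b := by
    intro g
    rw [Matrix.trace_mul_comm, ← Matrix.mul_assoc]
    simp only [Matrix.trace, Matrix.diag, Matrix.mul_apply (M := B * A)]
  have hc : ∀ a b, Continuous fun g : G.grp d => SyncGroup.mat g a b := fun a b =>
    SyncGroup.continuous_mat.matrix_elem a b
  have hi : ∀ a b, Integrable (fun g : G.grp d => (B * A) b a * SyncGroup.mat g a b) (G.unif d) :=
    fun a b => SyncGroup.integrable_of_continuous (continuous_const.mul (hc a b))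
  simp only [h]
  rw [integral_finsetSum _ fun b _ => integrable_finsetSum _ fun a _ => hi a b]
  refine Finset.sum_eq_zero fun b _ => ?_
  rw [integral_finsetSum _ fun a _ => hi a b]
  refine Finset.sum_eq_zero fun a _ => ?_
  rw [integral_const_mul, SyncGroup.integral_mat_apply hG, mul_zero]

theorem abs_trace_mul_mul_le {d : ℕ} {A Q B : Matrix (Fin d) (Fin d) ℝ}
    (hA : A ∈ Matrix.orthogonalGroup (Fin d) ℝ) (hQ : Q ∈ Matrix.orthogonalGroup (Fin d) ℝ)
    (hB : B ∈ Matrix.orthogonalGroup (Fin d) ℝ) : |(A * Q * B).trace| ≤ d := by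
  rw [Matrix.trace_mul_comm, ← Matrix.mul_assoc]
  have := abs_trace_transpose_mul_le_of_mem_orthogonalGroup
    (transpose_mem_orthogonalGroup (mul_mem hB hA)) hQ
  rwa [Matrix.transpose_transpose] at this

/-- Hoeffding-type bound for the moment generating function of a normalized trace. -/
theorem SyncGroup.integral_exp_trace_le {G : SyncGroup} {d : ℕ} (hd : 1 ≤ d)
    (hG : G = SyncGroup.special → 2 ≤ d) {A B : Matrix (Fin d) (Fin d) ℝ}
    (hA : A ∈ Matrix.orthogonalGroup (Fin d) ℝ) (hB : B ∈ Matrix.orthogonalGroup (Fin d) ℝ)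
    (l : ℝ) :
    ∫ g, Real.exp (l / d * (A * SyncGroup.mat g * B).trace) ∂G.unif d ≤ Real.cosh l := by
  have hd0 : (0 : ℝ) < d := by exact_mod_cast hd
  have hc : Continuous fun g : G.grp d => (A * SyncGroup.mat g * B).trace :=
    ((continuous_const.matrix_mul SyncGroup.continuous_mat).matrix_mul
      continuous_const).matrix_trace
  calc ∫ g, Real.exp (l / d * (A * SyncGroup.mat g * B).trace) ∂G.unif d
      ≤ ∫ g, (Real.cosh l + (A * SyncGroup.mat g * B).trace * (Real.sinh l / d)) ∂G.unif d := by
        refine integral_mono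
          (SyncGroup.integrable_of_continuous
            (Real.continuous_exp.comp (continuous_const.mul hc)))
          (SyncGroup.integrable_of_continuous
            (continuous_const.add (hc.mul continuous_const))) fun g => ?_
        have h := abs_trace_mul_mul_le hA (SyncGroup.mat_mem g) hB
        have h1 : |(A * SyncGroup.mat g * B).trace / d| ≤ 1 := by
          rw [abs_div, abs_of_pos hd0]
          exact (div_le_one hd0).mpr h
        -- Convexity: on `[-1, 1]` the exponential lies below its chord, and the linear part of the
        -- chord integrates to zero.
        have h2 := Real.exp_mul_le_cosh_add_mul_sinh h1 l
        dsimp only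
        rw [div_mul_eq_mul_div, mul_comm l, mul_div_right_comm, mul_div_assoc', mul_div_right_comm]
        exact h2
    _ = Real.cosh l := by
        rw [integral_add (integrable_const _)
          ((SyncGroup.integrable_of_continuous hc).mul_const _), integral_mul_const,
          SyncGroup.integral_trace_mul_mat_mul hG]
        simp

/-! ### Blocks of `A V` as sums over pairs of nodes -/

theorem blk_mul_groundTruth {n K d : ℕ} {G : SyncGroup}
    (A : Matrix (Fin n × Fin d) (Fin n × Fin d) ℝ) (C : Fin n → Fin K) (R : Fin n → G.grp d)
    (i : Fin n) (k : Fin K) :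
    blk (A * groundTruth C R) i k =
      ∑ j, if C j = k then blk A i j * SyncGroup.mat (R j) else 0 := by
  ext a b
  simp only [blk, groundTruth, Matrix.of_apply, Matrix.mul_apply, Fintype.sum_prod_type,
    Matrix.sum_apply]
  refine Finset.sum_congr rfl fun j _ => ?_
  split_ifs <;> simp [Matrix.mul_apply]

/-- The unordered pair `{i, j}`, as a coordinate `(min i j, max i j)` of the sample space. -/
def pairIdx {n : ℕ} (i j : Fin n) : Fin n × Fin n := (min i j, max i j)

/-- With `i` fixed, distinct `j` use distinct coordinates of the sample space, which makes the
summands at one node independent. -/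
theorem pairIdx_injective {n : ℕ} (i : Fin n) : Function.Injective (pairIdx i) := by
  intro j k h
  simp only [pairIdx, Prod.mk.injEq] at h
  rcases le_total i j with h1 | h1 <;> rcases le_total i k with h2 | h2 <;> simp_all

theorem cluster_eq_pairIdx_iff {n K : ℕ} (C : Fin n → Fin K) (i j : Fin n) :
    C (pairIdx i j).1 = C (pairIdx i j).2 ↔ C j = C i := by
  rcases le_total i j with h | h
  · simp [pairIdx, h, eq_comm]
  · simp [pairIdx, h]

/-- The weight of the block `(i, j)` inside a cluster, given the edge indicator. -/
def edgeWeight {n : ℕ} (i j : Fin n) (b : Bool) : ℝ := if j = i then 1 else if b then 1 else 0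

/-- The left factor of the trace pairing of `O` with the `j`-th summand of a block of `A V`. -/
def traceLeft {n d : ℕ} {G : SyncGroup} (R : Fin n → G.grp d) (O : Matrix (Fin d) (Fin d) ℝ)
    (i j : Fin n) : Matrix (Fin d) (Fin d) ℝ :=
  if i < j then O.transpose else (SyncGroup.mat (R j)).transpose

/-- The right factor of the trace pairing of `O` with the `j`-th summand of a block of `A V`. -/
def traceRight {n d : ℕ} {G : SyncGroup} (R : Fin n → G.grp d) (O : Matrix (Fin d) (Fin d) ℝ)
    (i j : Fin n) : Matrix (Fin d) (Fin d) ℝ :=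
  if i < j then SyncGroup.mat (R j) else O

theorem traceLeft_mem {n d : ℕ} {G : SyncGroup} (R : Fin n → G.grp d)
    {O : Matrix (Fin d) (Fin d) ℝ} (hO : O ∈ Matrix.orthogonalGroup (Fin d) ℝ) (i j : Fin n) :
    traceLeft R O i j ∈ Matrix.orthogonalGroup (Fin d) ℝ := by
  unfold traceLeft
  split_ifs
  · exact transpose_mem_orthogonalGroup hO
  · exact transpose_mem_orthogonalGroup (SyncGroup.mat_mem _)

theorem traceRight_mem {n d : ℕ} {G : SyncGroup} (R : Fin n → G.grp d)
    {O : Matrix (Fin d) (Fin d) ℝ} (hO : O ∈ Matrix.orthogonalGroup (Fin d) ℝ) (i j : Fin n) :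
    traceRight R O i j ∈ Matrix.orthogonalGroup (Fin d) ℝ := by
  unfold traceRight
  split_ifs
  · exact SyncGroup.mat_mem _
  · exact hO

theorem blk_observation {n K d : ℕ} {G : SyncGroup} (C : Fin n → Fin K) (R : Fin n → G.grp d)
    (ω : SGBMSpace n d G) (i j : Fin n) :
    blk (observation C R ω) i j = if i < j then obsUpper C R ω i j
      else if j < i then (obsUpper C R ω j i).transpose else 1 := by
  ext a b
  rfl

theorem blk_observation_mul_of_cluster_eq {n K d : ℕ} {G : SyncGroup} (C : Fin n → Fin K)
    (R : Fin n → G.grp d) (ω : SGBMSpace n d G) {i j : Fin n} (h : C j = C i) :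
    blk (observation C R ω) i j * SyncGroup.mat (R j) =
      edgeWeight i j (ω.1 (pairIdx i j)) • SyncGroup.mat (R i) := by
  have hR := (Matrix.mem_orthogonalGroup_iff' _ _).mp (SyncGroup.mat_mem (R j))
  rw [blk_observation]
  rcases lt_trichotomy i j with hij | rfl | hij
  · have : pairIdx i j = (i, j) := by simp [pairIdx, hij.le]
    rw [if_pos hij, this, obsUpper, edgeWeight, if_neg hij.ne', if_pos h.symm]
    split_ifs
    · rw [Matrix.mul_assoc, hR, Matrix.mul_one, one_smul]
    · simp
  · simp [edgeWeight]
  · have : pairIdx i j = (j, i) := by simp [pairIdx, hij.le]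
    rw [if_neg hij.not_gt, if_pos hij, this, obsUpper, edgeWeight, if_neg hij.ne, if_pos h]
    split_ifs
    · rw [Matrix.transpose_mul, Matrix.transpose_transpose, Matrix.mul_assoc, hR,
        Matrix.mul_one, one_smul]
    · simp

theorem trace_blk_observation_mul_of_cluster_ne {n K d : ℕ} {G : SyncGroup} (C : Fin n → Fin K)
    (R : Fin n → G.grp d) (ω : SGBMSpace n d G) (O : Matrix (Fin d) (Fin d) ℝ) {i j : Fin n}
    (h : C j ≠ C i) :
    (O.transpose * (blk (observation C R ω) i j * SyncGroup.mat (R j))).trace =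
      if ω.1 (pairIdx i j) = true then
        (traceLeft R O i j * SyncGroup.mat (ω.2 (pairIdx i j)) * traceRight R O i j).trace
      else 0 := by
  rw [blk_observation, traceLeft, traceRight]
  rcases lt_trichotomy i j with hij | rfl | hij
  · have : pairIdx i j = (i, j) := by simp [pairIdx, hij.le]
    rw [if_pos hij, if_pos hij, if_pos hij, this, obsUpper, if_neg h.symm]
    split_ifs
    · rw [Matrix.mul_assoc]
    · simp
  · exact absurd rfl h
  · have : pairIdx i j = (j, i) := by simp [pairIdx, hij.le]
    rw [if_neg hij.not_gt, if_pos hij, if_neg hij.not_gt, if_neg hij.not_gt, this, obsUpper,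
      if_neg h]
    split_ifs
    -- Below the diagonal the block is a transpose; transposing inside the trace restores an
    -- untransposed Haar element between two fixed orthogonal factors.
    · rw [← Matrix.trace_transpose]
      simp [Matrix.transpose_mul, Matrix.mul_assoc]
    · simp

/-- The total weight of the edges from `i` to its own cluster. -/
def ownWeight {n K d : ℕ} {G : SyncGroup} (C : Fin n → Fin K) (ω : SGBMSpace n d G)
    (i : Fin n) : ℝ :=
  ∑ j, if C j = C i then edgeWeight i j (ω.1 (pairIdx i j)) else 0

theorem ownWeight_nonneg {n K d : ℕ} {G : SyncGroup} (C : Fin n → Fin K) (ω : SGBMSpace n d G)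
    (i : Fin n) : 0 ≤ ownWeight C ω i := by
  refine Finset.sum_nonneg fun j _ => ?_
  unfold edgeWeight
  split_ifs <;> norm_num

theorem blockNuclear_own {n K d : ℕ} {G : SyncGroup} (C : Fin n → Fin K) (R : Fin n → G.grp d)
    (ω : SGBMSpace n d G) (i : Fin n) :
    blockNuclear (observation C R ω * groundTruth C R) i (C i) = d * ownWeight C ω i := by
  rw [← nuclearNorm_smul_of_mem_orthogonalGroup (SyncGroup.mat_mem (R i)) (ownWeight_nonneg C ω i)]
  change nuclearNorm (blk _ i (C i)) = _
  rw [blk_mul_groundTruth, ownWeight, Finset.sum_smul]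
  congr 1
  refine Finset.sum_congr rfl fun j _ => ?_
  split_ifs with h
  · exact blk_observation_mul_of_cluster_eq C R ω h
  · rw [zero_smul]

/-- The contribution of the pair `{i, j}` to the exponent in the Chernoff bound. -/
noncomputable def chernoffTerm {n K d : ℕ} {G : SyncGroup} (C : Fin n → Fin K) (R : Fin n → G.grp d)
    (O : Matrix (Fin d) (Fin d) ℝ) (l θ : ℝ) (i : Fin n) (k : Fin K) (j : Fin n)
    (x : Bool × G.grp d) : ℝ :=
  if C j = C i then -θ * edgeWeight i j x.1
  else if C j = k then
    if x.1 = true then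
      l / d * (traceLeft R O i j * SyncGroup.mat x.2 * traceRight R O i j).trace
    else 0
  else 0

theorem sum_chernoffTerm {n K d : ℕ} {G : SyncGroup} (C : Fin n → Fin K) (R : Fin n → G.grp d)
    (O : Matrix (Fin d) (Fin d) ℝ) (l θ : ℝ) {i : Fin n} {k : Fin K} (hk : k ≠ C i)
    (ω : SGBMSpace n d G) :
    ∑ j, chernoffTerm C R O l θ i k j (ω.1 (pairIdx i j), ω.2 (pairIdx i j)) =
      l / d * (O.transpose * blk (observation C R ω * groundTruth C R) i k).trace -
        θ * ownWeight C ω i := by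
  rw [blk_mul_groundTruth, ownWeight, Matrix.mul_sum, Matrix.trace_sum,
    Finset.mul_sum, Finset.mul_sum, ← Finset.sum_sub_distrib]
  refine Finset.sum_congr rfl fun j _ => ?_
  unfold chernoffTerm
  by_cases h1 : C j = C i
  · simp [h1, hk.symm]
  · by_cases h2 : C j = k
    · rw [if_neg h1, if_pos h2, if_pos h2, if_neg h1,
        trace_blk_observation_mul_of_cluster_ne C R ω O h1]
      split_ifs <;> simp
    · simp [h1, h2]

/-- At `l = 0` the foreign block disappears, so the same Chernoff estimate also gives the lower tail
of `ownWeight`. -/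
theorem sum_chernoffTerm_zero {n K d : ℕ} {G : SyncGroup} (C : Fin n → Fin K)
    (R : Fin n → G.grp d) (O : Matrix (Fin d) (Fin d) ℝ) (θ : ℝ) (i : Fin n) (k : Fin K)
    (ω : SGBMSpace n d G) :
    ∑ j, chernoffTerm C R O 0 θ i k j (ω.1 (pairIdx i j), ω.2 (pairIdx i j)) =
      -(θ * ownWeight C ω i) := by
  rw [ownWeight, Finset.mul_sum, ← Finset.sum_neg_distrib]
  refine Finset.sum_congr rfl fun j _ => ?_
  unfold chernoffTerm
  split_ifs <;> simp

/-! ### Independence and the Chernoff bound at one node -/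

instance {n K : ℕ} (C : Fin n → Fin K) (p q : unitInterval) (d : ℕ) (G : SyncGroup) :
    IsProbabilityMeasure (sgbmMeasure C p q d G) := by
  unfold sgbmMeasure
  infer_instance

/-- The joint law of the edge indicators and group elements is a product over pairs of nodes. -/
theorem measurePreserving_sgbmMeasure_pi {n K : ℕ} (C : Fin n → Fin K) (p q : unitInterval)
    (d : ℕ) (G : SyncGroup) :
    MeasurePreserving (fun (ω : SGBMSpace n d G) e => (ω.1 e, ω.2 e)) (sgbmMeasure C p q d G)
      (Measure.pi fun e : Fin n × Fin n =>
        (bernoulliMeasure true false (if C e.1 = C e.2 then p else q)).prod (G.unif d)) :=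
  (measurePreserving_arrowProdEquivProdArrow Bool (G.grp d) (Fin n × Fin n)
    (fun e => bernoulliMeasure true false (if C e.1 = C e.2 then p else q))
    (fun _ => G.unif d)).symm _

theorem measurePreserving_sgbmMeasure_coord {n K : ℕ} (C : Fin n → Fin K) (p q : unitInterval)
    (d : ℕ) (G : SyncGroup) (e : Fin n × Fin n) :
    MeasurePreserving (fun ω : SGBMSpace n d G => (ω.1 e, ω.2 e)) (sgbmMeasure C p q d G)
      ((bernoulliMeasure true false (if C e.1 = C e.2 then p else q)).prod (G.unif d)) :=
  (measurePreserving_eval (fun e : Fin n × Fin n =>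
    (bernoulliMeasure true false (if C e.1 = C e.2 then p else q)).prod (G.unif d)) e).comp
    (measurePreserving_sgbmMeasure_pi C p q d G)

theorem iIndepFun_sgbmMeasure_coord {n K : ℕ} (C : Fin n → Fin K) (p q : unitInterval)
    (d : ℕ) (G : SyncGroup) :
    iIndepFun (fun (e : Fin n × Fin n) (ω : SGBMSpace n d G) => (ω.1 e, ω.2 e))
      (sgbmMeasure C p q d G) := by
  have hc := fun e => measurePreserving_sgbmMeasure_coord C p q d G e
  rw [iIndepFun_iff_map_fun_eq_pi_map fun e => (hc e).measurable.aemeasurable,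
    (measurePreserving_sgbmMeasure_pi C p q d G).map_eq]
  congr 1
  funext e
  rw [(hc e).map_eq]

/-- Chernoff bound for a sum of functions of the independent pairs at a fixed node. -/
theorem sgbmMeasure_real_le_exp {n K d : ℕ} {G : SyncGroup} (C : Fin n → Fin K)
    (p q : unitInterval) (i : Fin n) {X : Fin n → Bool × G.grp d → ℝ}
    (hm : ∀ j, Measurable (X j)) {M : ℝ} (hM : ∀ j x, |X j x| ≤ M) {b : Fin n → ℝ}
    (hb : ∀ j, ∫ x, Real.exp (X j x)
      ∂((bernoulliMeasure true false (if C j = C i then p else q)).prod (G.unif d)) ≤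
        Real.exp (b j)) (t : ℝ) :
    (sgbmMeasure C p q d G).real
      {ω | t ≤ ∑ j, X j (ω.1 (pairIdx i j), ω.2 (pairIdx i j))} ≤
      Real.exp (-t + ∑ j, b j) := by
  set μ := sgbmMeasure C p q d G
  let Y : Fin n → SGBMSpace n d G → ℝ := fun j ω => X j (ω.1 (pairIdx i j), ω.2 (pairIdx i j))
  have hc := fun e => measurePreserving_sgbmMeasure_coord C p q d G e
  have hYm : ∀ j, Measurable (Y j) := fun j => (hm j).comp (hc _).measurable
  have hYi : iIndepFun Y μ :=
    ((iIndepFun_sgbmMeasure_coord C p q d G).precomp (pairIdx_injective i)).comp X hm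
  have hYint : ∀ j, Integrable (fun ω => Real.exp (1 * Y j ω)) μ := fun j =>
    Integrable.of_bound ((hYm j).const_mul 1).exp.aestronglyMeasurable (Real.exp M)
      (ae_of_all _ fun ω => by
        rw [Real.norm_eq_abs, Real.abs_exp, one_mul]
        exact Real.exp_le_exp.mpr ((le_abs_self _).trans (hM _ _)))
  have hmgf : ∀ j, mgf (Y j) μ 1 ≤ Real.exp (b j) := by
    intro j
    refine le_trans (le_of_eq ?_) (hb j)
    have h := hc (pairIdx i j)
    simp only [cluster_eq_pairIdx_iff] at h
    rw [← h.map_eq, integral_map h.measurable.aemeasurable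
      (hm j).exp.aestronglyMeasurable]
    simp [mgf, Y, μ]
  -- The moment parameter is 1 because the scales `l` and `θ` are already part of the summands.
  have h1 := measure_ge_le_exp_mul_mgf (μ := μ) (X := ∑ j, Y j) t zero_le_one
    (hYi.integrable_exp_mul_sum hYm fun j _ => hYint j)
  rw [hYi.mgf_sum hYm, neg_one_mul] at h1
  have hset : {ω | t ≤ (∑ j, Y j) ω} =
      {ω : SGBMSpace n d G | t ≤ ∑ j, X j (ω.1 (pairIdx i j), ω.2 (pairIdx i j))} := by
    ext ω
    simp [Y]
  rw [hset] at h1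
  refine h1.trans ?_
  rw [Real.exp_add, Real.exp_sum]
  exact mul_le_mul_of_nonneg_left
    (Finset.prod_le_prod (fun j _ => mgf_nonneg) fun j _ => hmgf j) (Real.exp_pos _).le

theorem integral_bernoulliMeasure_prod {d : ℕ} {G : SyncGroup} (r : unitInterval)
    {f : Bool × G.grp d → ℝ} (hf : Measurable f) {M : ℝ} (hM : ∀ x, |f x| ≤ M) :
    ∫ x, f x ∂((bernoulliMeasure true false r).prod (G.unif d)) =
      r * ∫ g, f (true, g) ∂G.unif d + (1 - r) * ∫ g, f (false, g) ∂G.unif d := by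
  rw [integral_prod _ (Integrable.of_bound hf.aestronglyMeasurable M
    (ae_of_all _ fun x => by rw [Real.norm_eq_abs]; exact hM x)), integral_bernoulliMeasure]
  rfl

section chernoffTerm

variable {n K d : ℕ} {G : SyncGroup} (C : Fin n → Fin K) (R : Fin n → G.grp d)
  {O : Matrix (Fin d) (Fin d) ℝ}

theorem measurable_chernoffTerm (l θ : ℝ) (i : Fin n) (k : Fin K) (j : Fin n) :
    Measurable (chernoffTerm C R O l θ i k j) := by
  have hc : Continuous fun g : G.grp d =>
      (traceLeft R O i j * SyncGroup.mat g * traceRight R O i j).trace :=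
    ((continuous_const.matrix_mul SyncGroup.continuous_mat).matrix_mul
      continuous_const).matrix_trace
  unfold chernoffTerm
  split_ifs
  · exact ((measurable_of_countable (edgeWeight i j)).comp measurable_fst).const_mul _
  · exact Measurable.ite (measurable_fst (measurableSet_singleton true))
      ((hc.measurable.comp measurable_snd).const_mul _) measurable_const
  · exact measurable_const

theorem abs_chernoffTerm_le (hO : O ∈ Matrix.orthogonalGroup (Fin d) ℝ)
    (l θ : ℝ) (i : Fin n) (k : Fin K) (j : Fin n) (x : Bool × G.grp d) :
    |chernoffTerm C R O l θ i k j x| ≤ |θ| + |l / d| * d := by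
  have h0 : 0 ≤ |l / d| * d := by positivity
  unfold chernoffTerm
  split_ifs with h1 h2 h3
  · have : |edgeWeight i j x.1| ≤ 1 := by
      unfold edgeWeight
      split_ifs <;> simp
    rw [abs_mul, abs_neg]
    have := mul_le_mul_of_nonneg_left this (abs_nonneg θ)
    linarith
  · rw [abs_mul]
    have := mul_le_mul_of_nonneg_left (abs_trace_mul_mul_le (traceLeft_mem R hO i j)
      (SyncGroup.mat_mem x.2) (traceRight_mem R hO i j)) (abs_nonneg (l / d))
    linarith [abs_nonneg θ]
  all_goals
    rw [abs_zero]
    positivity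

/-- Bound for the logarithm of the moment generating function of `chernoffTerm`. -/
noncomputable def chernoffExponent (C : Fin n → Fin K) (p q : unitInterval) (l θ : ℝ) (i : Fin n)
    (k : Fin K) (j : Fin n) : ℝ :=
  if C j = C i then -(p * (1 - Real.exp (-θ)))
  else if C j = k then q * (Real.cosh l - 1) else 0

theorem integral_exp_chernoffTerm_le (hd : 1 ≤ d) (hG : G = SyncGroup.special → 2 ≤ d)
    (hO : O ∈ Matrix.orthogonalGroup (Fin d) ℝ) (p q : unitInterval) (l : ℝ) {θ : ℝ} (hθ : 0 ≤ θ)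
    (i : Fin n) (k : Fin K) (j : Fin n) :
    ∫ x, Real.exp (chernoffTerm C R O l θ i k j x)
      ∂((bernoulliMeasure true false (if C j = C i then p else q)).prod (G.unif d)) ≤
      Real.exp (chernoffExponent C p q l θ i k j) := by
  rw [integral_bernoulliMeasure_prod _ (measurable_chernoffTerm C R l θ i k j).exp
    (M := Real.exp (|θ| + |l / d| * d)) fun x => by
      rw [Real.abs_exp]
      exact Real.exp_le_exp.mpr ((le_abs_self _).trans (abs_chernoffTerm_le C R hO l θ i k j x))]
  have hp := p.2.1
  have hp1 := p.2.2
  have hq := q.2.1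
  have heθ : Real.exp (-θ) ≤ 1 := Real.exp_le_one_iff.mpr (by linarith)
  unfold chernoffTerm chernoffExponent
  by_cases h1 : C j = C i
  · simp only [if_pos h1]
    refine le_trans ?_ (Real.add_one_le_exp _)
    unfold edgeWeight
    by_cases hij : j = i
    -- The diagonal weight is always 1, and `e^{-θ} ≤ 1 - p (1 - e^{-θ})` since `p ≤ 1`; the node
    -- itself thus counts as an ordinary edge, giving exactly `m` factors.
    · simp only [if_pos hij, mul_one, integral_const, probReal_univ, one_smul]
      nlinarith
    · simp [hij]
      nlinarith
  · simp only [if_neg h1]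
    by_cases h2 : C j = k
    · simp only [if_pos h2, if_true]
      refine le_trans ?_ (Real.add_one_le_exp _)
      have := mul_le_mul_of_nonneg_left (SyncGroup.integral_exp_trace_le hd hG
        (traceLeft_mem R hO i j) (traceRight_mem R hO i j) l) hq
      simp
      linarith
    · simp [h2]

/-- The exponential tail bound at a single node, with `m = n / K`. -/
theorem sgbmMeasure_real_chernoffTerm_le (hK : 1 ≤ K) (hd : 1 ≤ d)
    (hG : G = SyncGroup.special → 2 ≤ d) (hC : IsClustering C)
    (hO : O ∈ Matrix.orthogonalGroup (Fin d) ℝ) (p q : unitInterval) (l : ℝ) {θ : ℝ} (hθ : 0 ≤ θ)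
    (i : Fin n) (k : Fin K) (t : ℝ) :
    (sgbmMeasure C p q d G).real
      {ω | t ≤ ∑ j, chernoffTerm C R O l θ i k j (ω.1 (pairIdx i j), ω.2 (pairIdx i j))} ≤
      Real.exp (-t + (n / K * (q * (Real.cosh l - 1)) - n / K * (p * (1 - Real.exp (-θ))))) := by
  refine (sgbmMeasure_real_le_exp C p q i (measurable_chernoffTerm C R l θ i k)
    (abs_chernoffTerm_le C R hO l θ i k)
    (integral_exp_chernoffTerm_le C R hd hG hO p q l hθ i k) t).trans ?_
  refine Real.exp_le_exp.mpr (add_le_add_right ?_ _)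
  have hcard : ∀ (k : Fin K) (c : ℝ), ∑ j, (if C j = k then c else 0) = n / K * c := by
    intro k c
    have hK' : (K : ℝ) ≠ 0 := by positivity
    have h : (K : ℝ) * (Finset.univ.filter fun i => C i = k).card = n := by exact_mod_cast hC k
    rw [← Finset.sum_filter, Finset.sum_const, nsmul_eq_mul, ← h, mul_div_cancel_left₀ _ hK']
  -- Needed for `k = C i`, where the exponent has no `q` term and the stated bound adds a
  -- nonnegative one.
  have hnonneg : 0 ≤ q * (Real.cosh l - 1) :=
    mul_nonneg q.2.1 (sub_nonneg.mpr (Real.one_le_cosh l))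
  rw [← hcard k, ← hcard (C i), ← Finset.sum_sub_distrib]
  refine Finset.sum_le_sum fun j _ => ?_
  unfold chernoffExponent
  split_ifs <;> linarith

end chernoffTerm

/-! ### The parameter region and the choice of Chernoff parameters -/

theorem sqrt_two_mul_pos {K : ℕ} (hK : 1 ≤ K) {β : ℝ} (hβ : 0 < β) :
    0 < Real.sqrt (2 * K * β) := by
  have : (0 : ℝ) < K := by exact_mod_cast hK
  positivity

theorem InRegion.lt_sub_mul_log {K : ℕ} (hK : 1 ≤ K) {α β : ℝ} (hα : 0 < α) (hβ : 0 < β)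
    (h : InRegion K α β) :
    (K : ℝ) < α - Real.sqrt (2 * K * β) -
      Real.sqrt (2 * K * β) * Real.log (α / Real.sqrt (2 * K * β)) := by
  have hs := sqrt_two_mul_pos hK hβ
  have h2 := h.2
  rw [mul_div_assoc, Real.log_mul (Real.exp_pos 1).ne' (div_pos hα hs).ne', Real.log_exp] at h2
  linarith

/-- The Chernoff exponent `a (1 - e⁻ˡ) - (τ² / 2) (cosh l - 1)` exceeds `1` for some `l` as soon as
`a > 1 + τ`. -/
theorem exists_chernoff_exponent_lt {a τ : ℝ} (hτ : 0 < τ) (ha : 1 + τ < a) :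
    ∃ l : ℝ, 0 < l ∧ τ ^ 2 / 2 * (Real.cosh l - 1) - a * (1 - Real.exp (-l)) < -1 := by
  set s := Real.sqrt (a + τ ^ 2 / 4)
  have hs2 : s ^ 2 = a + τ ^ 2 / 4 := Real.sq_sqrt (by nlinarith [sq_nonneg τ])
  have hs : 1 + τ / 2 < s := Real.lt_sqrt_of_sq_lt (by nlinarith)
  have hs0 : 0 < s := by linarith
  have hx : 0 < 2 * s / τ := by positivity
  -- The exact minimizer: the derivative in `l` vanishes when `e^{2l} τ² / 4 = a + τ² / 4 = s²`, and
  -- the minimum is `-(s - τ/2)²`.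
  refine ⟨Real.log (2 * s / τ), Real.log_pos ((one_lt_div hτ).mpr (by linarith)), ?_⟩
  rw [Real.cosh_eq, Real.exp_neg, Real.exp_log hx]
  have : τ ^ 2 / 2 * ((2 * s / τ + (2 * s / τ)⁻¹) / 2 - 1) - a * (1 - (2 * s / τ)⁻¹) =
      -(s - τ / 2) ^ 2 := by
    have ha' : a = s ^ 2 - τ ^ 2 / 4 := by linarith
    rw [ha']
    field_simp
    ring
  rw [this]
  nlinarith

theorem InRegion.exists_chernoff_parameters {K : ℕ} (hK : 1 ≤ K) {α β : ℝ} (hα : 0 < α)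
    (hβ : 0 < β) (h : InRegion K α β) :
    ∃ l ε : ℝ, 0 < l ∧ 0 < ε ∧ ε < 1 ∧
      l * ε * (α / K) + (β / K * (Real.cosh l - 1) -
        α / K * (1 - Real.exp (-(l * (1 - ε))))) < -1 := by
  have hK0 : (0 : ℝ) < K := by exact_mod_cast hK
  have hs := sqrt_two_mul_pos hK hβ
  have hlog : 0 < Real.log (α / Real.sqrt (2 * K * β)) :=
    Real.log_pos ((one_lt_div hs).mpr h.1)
  have h1 := h.lt_sub_mul_log hK hα hβ
  have ha : 1 + Real.sqrt (2 * K * β) / K < α / K := by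
    rw [← sub_pos]
    have h2 := mul_pos hs hlog
    have : α / K - (1 + Real.sqrt (2 * K * β) / K) = (α - Real.sqrt (2 * K * β) - K) / K := by
      field_simp
      ring
    rw [this]
    exact div_pos (by linarith) hK0
  obtain ⟨l, hl, hlt⟩ := exists_chernoff_exponent_lt (div_pos hs hK0) ha
  have hb : (Real.sqrt (2 * K * β) / K) ^ 2 / 2 = β / K := by
    rw [div_pow, Real.sq_sqrt (by positivity)]
    field_simp
  rw [hb] at hlt
  -- The strict inequality at `ε = 0` persists for small `ε > 0` by continuity; the same `ε` pays
  -- for the net and for the separation margin.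
  let f : ℝ → ℝ := fun ε => l * ε * (α / K) + (β / K * (Real.cosh l - 1) -
        α / K * (1 - Real.exp (-(l * (1 - ε)))))
  have hf : ContinuousAt f 0 := by
    apply Continuous.continuousAt
    fun_prop
  have hf0 : f 0 < -1 := by simpa [f] using hlt
  have h3 : ∀ᶠ ε in nhdsWithin (0 : ℝ) (Set.Ioi 0), f ε < -1 :=
    (hf.eventually_lt_const hf0).filter_mono nhdsWithin_le_nhds
  obtain ⟨ε, hε, hε0, hε1⟩ := (h3.and (Ioo_mem_nhdsGT (zero_lt_one' ℝ))).exists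
  exact ⟨l, ε, hl, hε0, hε1, hε⟩

theorem exists_inRegion_below_threshold {K : ℕ} (hK : 1 ≤ K) :
    ∃ α β : ℝ, 0 < α ∧ 0 < β ∧ InRegion K α β ∧ Real.sqrt α - Real.sqrt β < Real.sqrt K := by
  have hK0 : (0 : ℝ) < K := by exact_mod_cast hK
  have hs : Real.sqrt (2 * K * (200 * K)) = 20 * K := by
    rw [show (2 * K * (200 * K) : ℝ) = (20 * K) ^ 2 by ring, Real.sqrt_sq (by positivity)]
  -- With `α = β` the information-theoretic difference is zero, while `√(2Kβ)` grows only like the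
  -- square root of `β`; the value `200 K` makes it the integer multiple `20 K`.
  refine ⟨200 * K, 200 * K, by positivity, by positivity, ⟨?_, ?_⟩, ?_⟩
  · rw [hs]
    linarith
  · rw [hs, show Real.exp 1 * (200 * K) / (20 * K) = Real.exp 1 * 10 by field_simp; norm_num,
      Real.log_mul (Real.exp_pos 1).ne' (by norm_num), Real.log_exp]
    have h2 : Real.log 10 < 4 := by
      rw [Real.log_lt_iff_lt_exp (by norm_num)]
      have h3 : (2 : ℝ) ^ 4 < Real.exp 1 ^ 4 :=
        pow_lt_pow_left₀ (by linarith [Real.exp_one_gt_d9]) (by norm_num) (by norm_num)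
      rw [← Real.exp_nat_mul] at h3
      norm_num at h3
      linarith
    nlinarith
  · rw [sub_self]
    exact Real.sqrt_pos.mpr hK0

/-! ### Union bound over nodes, clusters and net points -/

/-- Failure of separation forces a large value of the sum in the Chernoff bound. -/
theorem exists_le_sum_chernoffTerm {n K d : ℕ} {G : SyncGroup} (hd : 1 ≤ d) (C : Fin n → Fin K)
    (R : Fin n → G.grp d) (ω : SGBMSpace n d G) {ε l δ : ℝ} (hε : 0 < ε) (hε1 : ε < 1)
    (hl : 0 < l) (hδ : 0 ≤ δ) {N : Finset (Matrix (Fin d) (Fin d) ℝ)}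
    (hN : ∀ S : Matrix (Fin d) (Fin d) ℝ, ∃ O ∈ N,
      (1 - ε) * nuclearNorm S ≤ (O.transpose * S).trace) {i : Fin n} {k : Fin K} (hk : k ≠ C i)
    (h : blockNuclear (observation C R ω * groundTruth C R) i (C i) -
      blockNuclear (observation C R ω * groundTruth C R) i k < δ) :
    ∃ O ∈ N, -(l * δ) ≤
      ∑ j, chernoffTerm C R O l (l * (1 - ε)) i k j (ω.1 (pairIdx i j), ω.2 (pairIdx i j)) := by
  have hd0 : (1 : ℝ) ≤ d := by exact_mod_cast hd
  obtain ⟨O, hO, htr⟩ := hN (blk (observation C R ω * groundTruth C R) i k)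
  refine ⟨O, hO, ?_⟩
  rw [sum_chernoffTerm C R O l _ hk, blockNuclear_own] at *
  change d * ownWeight C ω i - nuclearNorm (blk (observation C R ω * groundTruth C R) i k) < δ at h
  set S := blk (observation C R ω * groundTruth C R) i k
  set W := ownWeight C ω i
  have h1 : (1 - ε) * (d * W - δ) ≤ (O.transpose * S).trace :=
    (mul_le_mul_of_nonneg_left (by linarith) (by linarith)).trans htr
  have h2 : -δ ≤ (O.transpose * S).trace / d - (1 - ε) * W := by
    have h3 : (1 - ε) * (d * W - δ) / d ≤ (O.transpose * S).trace / d :=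
      div_le_div_of_nonneg_right h1 (by linarith)
    have h4 : (1 - ε) * (d * W - δ) / d = (1 - ε) * W - (1 - ε) * (δ / d) := by
      field_simp
    have h5 : δ / d ≤ δ := div_le_self hδ hd0
    -- With `δ / d ≤ δ` this gives `(1 - ε) δ / d ≤ δ`, so the margin needs no factor depending on
    -- `d`.
    have h6 : 0 ≤ δ / d := by positivity
    nlinarith
  have h7 := mul_le_mul_of_nonneg_left h2 hl.le
  calc -(l * δ) = l * -δ := by ring
    _ ≤ _ := h7
    _ = _ := by ring

theorem theorem2 (K d : ℕ) (hK : 1 ≤ K) (hd : 1 ≤ d) (G : SyncGroup)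
    (hG : G = SyncGroup.special → 2 ≤ d) :
    (∀ α β : ℝ, 0 < α → 0 < β → InRegion K α β →
      ∃ χ : ℝ, 0 < χ ∧ ∃ c : ℝ, 0 < c ∧ ∃ N : ℕ, ∀ n : ℕ, N ≤ n →
        ∀ p q : unitInterval,
          (p : ℝ) = α * Real.log n / n → (q : ℝ) = β * Real.log n / n →
        ∀ (C : Fin n → Fin K) (R : Fin n → G.grp d), IsClustering C →
          1 - (n : ℝ) ^ (-c) ≤
            (sgbmMeasure C p q d G).real
              {ω | PreservesBySeparation (observation C R ω) C (groundTruth C R)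
                    (χ * ((n : ℝ) / K) * p) ∧
                  ∀ i : Fin n,
                    Real.sqrt (2 * K * β) / α * ((n : ℝ) / K) * p ≤
                      blockNuclear (observation C R ω * groundTruth C R) i (C i)}) ∧
    (∃ α β : ℝ, 0 < α ∧ 0 < β ∧ InRegion K α β ∧
      Real.sqrt α - Real.sqrt β < Real.sqrt K) := by
  refine ⟨fun α β hα hβ hreg => ?_, exists_inRegion_below_threshold hK⟩
  have hK0 : (0 : ℝ) < K := by exact_mod_cast hK
  have hd1 : (1 : ℝ) ≤ d := by exact_mod_cast hd
  have hs := sqrt_two_mul_pos hK hβ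
  obtain ⟨l, ε, hl, hε, hε1, hexp⟩ := hreg.exists_chernoff_parameters hK hα hβ
  obtain ⟨𝒩, h𝒩, hnet⟩ := exists_finite_net_nuclearNorm d hε
  set τ := Real.sqrt (2 * K * β)
  set θ := Real.log (α / τ)
  have hθ0 : 0 < θ := Real.log_pos ((one_lt_div hs).mpr hreg.1)
  have hexpθ : Real.exp (-θ) = τ / α := by
    rw [Real.exp_neg, Real.exp_log (div_pos hα hs), inv_div]
  have hlogs : 1 < (α - τ - τ * θ) / K :=
    (one_lt_div hK0).mpr (hreg.lt_sub_mul_log hK hα hβ)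
  set F := -(l * ε * (α / K) + (β / K * (Real.cosh l - 1) -
        α / K * (1 - Real.exp (-(l * (1 - ε))))))
  have hF : 1 < F := by
    simp only [F]
    linarith
  set H := min F ((α - τ - τ * θ) / K)
  have hH : 1 < H := lt_min hF hlogs
  -- Half of the excess `H - 1` absorbs the constant `M`, which counts the bad events per node; the
  -- other half is the final rate.
  set c := (H - 1) / 2 with hc
  have hc0 : 0 < c := by linarith
  set M : ℝ := 1 + K * 𝒩.card
  have hM : ∀ᶠ n : ℕ in Filter.atTop, M ≤ (n : ℝ) ^ c :=
    ((tendsto_rpow_atTop hc0).comp tendsto_natCast_atTop_atTop).eventually_ge_atTop M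
  obtain ⟨N, hN⟩ := Filter.eventually_atTop.mp (hM.and (Filter.eventually_ge_atTop 2))
  refine ⟨ε, hε, c, hc0, N, fun n hn p q hp hq C R hC => ?_⟩
  obtain ⟨hMn, hn2⟩ := hN n hn
  have hn0 : (0 : ℝ) < n := by positivity
  set L := Real.log n
  have hL : 0 < L := Real.log_pos (by exact_mod_cast hn2)
  have hmp : (n : ℝ) / K * p = α / K * L := by
    rw [hp]
    field_simp
  have hmq : (n : ℝ) / K * q = β / K * L := by
    rw [hq]
    field_simp
  have hmp0 : 0 < α / K * L := by positivity
  have hrpow : ∀ x, (n : ℝ) ^ x = Real.exp (x * L) := fun x => by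
    rw [Real.rpow_def_of_pos hn0, mul_comm]
  set μ := sgbmMeasure C p q d G
  -- At `l = 0` the matrix 1 and the cluster `C i` are placeholders. The tilt `θ = log (α / τ)` is
  -- the optimal one for the threshold `τ / α` times the mean `m p`.
  let E₁ : Fin n → Set (SGBMSpace n d G) := fun i =>
    {ω | -(θ * (τ / α * (α / K * L))) ≤
      ∑ j, chernoffTerm C R 1 0 θ i (C i) j (ω.1 (pairIdx i j), ω.2 (pairIdx i j))}
  let E₂ : Fin n → Fin K → Matrix (Fin d) (Fin d) ℝ → Set (SGBMSpace n d G) := fun i k O =>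
    {ω | -(l * (ε * (α / K * L))) ≤
      ∑ j, chernoffTerm C R O l (l * (1 - ε)) i k j (ω.1 (pairIdx i j), ω.2 (pairIdx i j))}
  have hE₁ : ∀ i, μ.real (E₁ i) ≤ (n : ℝ) ^ (-H) := by
    intro i
    refine (sgbmMeasure_real_chernoffTerm_le C R hK hd hG hC (one_mem _) p q 0 hθ0.le i (C i)
      _).trans ?_
    rw [hrpow]
    refine Real.exp_le_exp.mpr ?_
    rw [← mul_assoc ((n : ℝ) / K) (q : ℝ),
      ← mul_assoc ((n : ℝ) / K) (p : ℝ), hmp, hexpθ, Real.cosh_zero]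
    have h1 : - -(θ * (τ / α * (α / K * L))) + (↑n / ↑K * ↑q * (1 - 1) -
        α / ↑K * L * (1 - τ / α)) = -((α - τ - τ * θ) / K) * L := by
      field_simp
      ring
    rw [h1]
    exact mul_le_mul_of_nonneg_right (neg_le_neg (min_le_right _ _)) hL.le
  have hE₂ : ∀ i k, ∀ O ∈ 𝒩, μ.real (E₂ i k O) ≤ (n : ℝ) ^ (-H) := by
    intro i k O hO
    refine (sgbmMeasure_real_chernoffTerm_le C R hK hd hG hC (h𝒩 O hO) p q l
      (mul_nonneg hl.le (by linarith)) i k _).trans ?_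
    rw [hrpow]
    refine Real.exp_le_exp.mpr ?_
    rw [← mul_assoc ((n : ℝ) / K) (q : ℝ),
      ← mul_assoc ((n : ℝ) / K) (p : ℝ), hmp, hmq]
    have h1 : - -(l * (ε * (α / K * L))) + (β / K * L * (Real.cosh l - 1) -
        α / K * L * (1 - Real.exp (-(l * (1 - ε))))) = -F * L := by
      simp only [F]
      ring
    rw [h1]
    exact mul_le_mul_of_nonneg_right (neg_le_neg (min_le_left _ _)) hL.le
  set good : Set (SGBMSpace n d G) :=
    {ω | PreservesBySeparation (observation C R ω) C (groundTruth C R)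
          (ε * ((n : ℝ) / K) * p) ∧
        ∀ i : Fin n, τ / α * ((n : ℝ) / K) * p ≤
          blockNuclear (observation C R ω * groundTruth C R) i (C i)}
  have hbad : goodᶜ ⊆ ⋃ i, (E₁ i ∪ ⋃ k, ⋃ O ∈ 𝒩, E₂ i k O) := by
    intro ω hω
    by_contra hcon
    simp only [Set.mem_iUnion, Set.mem_union, not_exists, not_or] at hcon
    refine hω ⟨⟨?_, fun i k hk => ?_⟩, fun i => ?_⟩
    · rw [mul_assoc, hmp]
      positivity
    · rw [mul_assoc, hmp]
      by_contra! hlt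
      obtain ⟨O, hO, hle⟩ := exists_le_sum_chernoffTerm hd C R ω hε hε1 hl (by positivity) hnet hk
        hlt
      exact (hcon i).2 k O hO hle
    · rw [mul_assoc, hmp]
      by_contra! hlt
      rw [blockNuclear_own] at hlt
      refine (hcon i).1 ?_
      simp only [E₁, Set.mem_ofPred_eq]
      rw [sum_chernoffTerm_zero]
      have hW := ownWeight_nonneg C ω i
      -- Since `d ≥ 1`, a small nuclear norm `d W` forces a small `W`.
      have : ownWeight C ω i ≤ τ / α * (α / K * L) := by nlinarith
      exact neg_le_neg (mul_le_mul_of_nonneg_left this hθ0.le)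
  have hsum : μ.real goodᶜ ≤ n * (M * (n : ℝ) ^ (-H)) := by
    calc μ.real goodᶜ ≤ μ.real (⋃ i, (E₁ i ∪ ⋃ k, ⋃ O ∈ 𝒩, E₂ i k O)) := measureReal_mono hbad
      _ ≤ ∑ i : Fin n, μ.real (E₁ i ∪ ⋃ k, ⋃ O ∈ 𝒩, E₂ i k O) := measureReal_iUnion_fintype_le _
      _ ≤ ∑ i : Fin n, M * (n : ℝ) ^ (-H) := by
          refine Finset.sum_le_sum fun i _ => ?_
          have h1 : μ.real (⋃ k, ⋃ O ∈ 𝒩, E₂ i k O) ≤ K * (𝒩.card * (n : ℝ) ^ (-H)) := by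
            calc _ ≤ ∑ k : Fin K, μ.real (⋃ O ∈ 𝒩, E₂ i k O) := measureReal_iUnion_fintype_le _
              _ ≤ ∑ k : Fin K, ∑ O ∈ 𝒩, μ.real (E₂ i k O) :=
                  Finset.sum_le_sum fun k _ => measureReal_biUnion_finset_le _ _
              _ ≤ ∑ k : Fin K, ∑ O ∈ 𝒩, (n : ℝ) ^ (-H) :=
                  Finset.sum_le_sum fun k _ => Finset.sum_le_sum fun O hO => hE₂ i k O hO
              _ = _ := by simp
          calc _ ≤ μ.real (E₁ i) + μ.real (⋃ k, ⋃ O ∈ 𝒩, E₂ i k O) := measureReal_union_le _ _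
            _ ≤ (n : ℝ) ^ (-H) + K * (𝒩.card * (n : ℝ) ^ (-H)) := add_le_add (hE₁ i) h1
            _ = M * (n : ℝ) ^ (-H) := by
              simp only [M]
              ring
      _ = _ := by simp
  have hfin : n * (M * (n : ℝ) ^ (-H)) ≤ (n : ℝ) ^ (-c) := by
    calc n * (M * (n : ℝ) ^ (-H)) ≤ n * ((n : ℝ) ^ c * (n : ℝ) ^ (-H)) := by gcongr
      _ = (n : ℝ) ^ (1 + (c + -H)) := by
          rw [Real.rpow_add hn0, Real.rpow_add hn0, Real.rpow_one]
      _ = (n : ℝ) ^ (-c) := by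
          congr 1
          linarith
  -- Subadditivity alone bounds the good event from below, so its measurability plays no role.
  have huniv : 1 ≤ μ.real good + μ.real goodᶜ := by
    have := measureReal_union_le (μ := μ) good goodᶜ
    rwa [Set.union_compl_self, probReal_univ] at this
  linarith
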